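/- Let $n,p,m\ge 1$, let $X\in\mathbb R^{n\times p}$ be a fixed design and $Y$ a random $n\times m$ matrix. Let $l_0(\eta;Y)$ be a real-valued loss, differentiable in $\eta\in\mathbb R^{n\times m}$, and let $B^*\in\mathbb R^{p\times m}$. Suppose that the effective noise $E=-\nabla l_0(XB^*;Y)$ has mean zero and is sub-Gaussian with scale bounded by $\sigma\ge 0$, i.e. $\|\langle E,\alpha\rangle\|_{\psi_2}\le\sigma\|\alpha\|_F$ for all $\alpha\in\mathbb R^{n\times m}$, where $\|Z\|_{\psi_2}=\inf\{t>0:\mathbb E\exp(Z^2/t^2)\le 2\}$. For $B\in\mathbb R^{p\times m}$ with rows $b_1,\dots,b_p$, let $q(B)$ be the number of distinct rows, let $g_1,\dots,g_{q(B)}$ be the sizes of the groups of equal rows, and put $\mathcal C(B)=\frac12\sum_{i=1}^{q(B)}g_i(p-g_i)$, which is the number of pairs $j<j'$ with $b_j\ne b_{j'}$. Let $\Delta_{l_0}(\alpha,\beta)=l_0(\alpha;Y)-l_0(\beta;Y)-\langle\nabla l_0(\beta;Y),\alpha-\beta\rangle$, $\mathbf D_2(\alpha,\beta)=\|\alpha-\beta\|_F^2/2$,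 and $\lambda_o=\sigma\sqrt{(p\vee m)/p}$. Assume that for some (non-random) $\delta>0$, $K\ge0$, almost surely, $$\Delta_{l_0}(XB_1,XB_2)+K\lambda_o^2\,\mathcal C(B_1)+K\lambda_o^2\,\mathcal C(B_2)\ \ge\ \delta\,\mathbf D_2(XB_1,XB_2)\qquad\text{for all }B_1,B_2\in\mathbb R^{p\times m}.$$ Let $\lambda=A\sqrt{K\vee(1/\delta)}\,\lambda_o$ and let $\hat B$ be an optimal solution of $$\min_{B\in\mathbb R^{p\times m}}\ l_0(XB;Y)+\frac{\lambda^2}{2}\sum_{1\le j<j'\le p}1_{b_j\neq b_{j'}}.$$ There is a universal constant $A_0>0$ such that for every $A\ge A_0$ there is a constant $c>0$, depending only on $A$, such that in every such situation, with $q^*=q(B^*)$ and $r^*=\operatorname{rank}(B^*)$, $$\mathbb E\|X\hat B-XB^*\|_F^2\ \le\ c\,\frac{(K\delta\vee1)\sigma^2}{\delta^2}\Big\{m+\frac{m\vee p}{p}\,\mathcal C(B^*)\Big\},$$ $$\frac{(K\delta\vee1)\sigma^2}{\delta^2}\Big\{m+\frac{m\vee p}{p}\,\mathcal C(B^*)\Big\}\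 \le\ \frac{(K\delta\vee1)\sigma^2}{\delta^2}\Big\{m+(m\vee p)\Big(p-\frac{p}{q^*}\Big)\Big\}.$$ Moreover, the first rate is, up to the constant, never smaller than the corresponding rate of clustered reduced-rank learning (CRL) at $q=q^*$, $r=r^*$: $$\frac{(K\delta\vee1)\sigma^2}{\delta^2}\big\{(q^*\wedge\operatorname{rank}X+m)\,r^*+(p-q^*)\log q^*+1\big\}\ \le\ c\,\frac{(K\delta\vee1)\sigma^2}{\delta^2}\Big\{m+\frac{m\vee p}{p}\,\mathcal C(B^*)\Big\}.$$ -/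

import Mathlib

open MeasureTheory
open scoped ENNReal NNReal

attribute [local instance] Matrix.frobeniusNormedAddCommGroup
attribute [local instance] Matrix.frobeniusNormedSpace

noncomputable section

namespace PairwiseL0

/-- The inner product `⟨A, B⟩ = ∑ᵢⱼ Aᵢⱼ Bᵢⱼ` of matrices. -/
def frobInner {n m : ℕ} (A B : Matrix (Fin n) (Fin m) ℝ) : ℝ :=
  ∑ i, ∑ j, A i j * B i j

/-- The gradient matrix of `ψ` at `η`: the matrix of its partial derivatives. -/
def matGrad {n m : ℕ} (ψ : Matrix (Fin n) (Fin m) ℝ → ℝ) (η : Matrix (Fin n) (Fin m) ℝ) :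
    Matrix (Fin n) (Fin m) ℝ :=
  Matrix.of fun i j => fderiv ℝ ψ η (Matrix.single i j 1)

/-- The generalized Bregman function
`Δ_ψ(α, β) = ψ(α) - ψ(β) - ⟨∇ψ(β), α - β⟩`. -/
def bregman {n m : ℕ} (ψ : Matrix (Fin n) (Fin m) ℝ → ℝ)
    (α β : Matrix (Fin n) (Fin m) ℝ) : ℝ :=
  ψ α - ψ β - frobInner (matGrad ψ β) (α - β)

/-- `D₂(α, β) = ‖α - β‖_F² / 2`; the norm is the Frobenius norm. -/
def D2 {n m : ℕ} (α β : Matrix (Fin n) (Fin m) ℝ) : ℝ :=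
  ‖α - β‖ ^ 2 / 2

/-- The Orlicz norm `inf {t > 0 : 𝔼 exp((Z/t)²) ≤ 2}`, with value `∞` if there is no such `t`. -/
def psi2Norm {Ω : Type*} [MeasurableSpace Ω] (μ : Measure Ω) (Z : Ω → ℝ) : ℝ≥0∞ :=
  ⨅ (t : ℝ≥0) (_ : 0 < t ∧ ∫⁻ ω, ENNReal.ofReal (Real.exp ((Z ω / t) ^ 2)) ∂μ ≤ 2), (t : ℝ≥0∞)

/-- `vec(E)` is a sub-Gaussian random vector with mean zero and scale bounded by `σ`. -/
structure IsSubGaussianNoise {Ω : Type*} [MeasurableSpace Ω] (μ : Measure Ω) {n m : ℕ}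
    (E : Ω → Matrix (Fin n) (Fin m) ℝ) (σ : ℝ) : Prop where
  aemeasurable : ∀ i j, AEMeasurable (fun ω => E ω i j) μ
  mean_zero : ∀ i j, ∫ ω, E ω i j ∂μ = 0
  psi2_le : ∀ α : Matrix (Fin n) (Fin m) ℝ,
    psi2Norm μ (fun ω => frobInner (E ω) α) ≤ ENNReal.ofReal (σ * ‖α‖)

/-- The set of distinct rows of `B`; they label the row groups. -/
def distinctRows {p m : ℕ} (B : Matrix (Fin p) (Fin m) ℝ) : Finset (Fin m → ℝ) :=
  Finset.univ.image fun j => B.row j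

/-- The number `q(B)` of distinct rows of `B`. -/
def numGroups {p m : ℕ} (B : Matrix (Fin p) (Fin m) ℝ) : ℕ :=
  (distinctRows B).card

/-- The size of the group of rows of `B` that are equal to `v`. -/
def groupSize {p m : ℕ} (B : Matrix (Fin p) (Fin m) ℝ) (v : Fin m → ℝ) : ℕ :=
  (Finset.univ.filter fun j => B.row j = v).card

/-- `𝒞(B) = (1/2) ∑ᵢ gᵢ (p - gᵢ)`, the sum being over the groups of equal rows of `B`. -/
def clusterPen {p m : ℕ} (B : Matrix (Fin p) (Fin m) ℝ) : ℝ :=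
  (1 / 2) * ∑ v ∈ distinctRows B, (groupSize B v : ℝ) * ((p : ℝ) - groupSize B v)

/-- The `ℓ₀` penalty on pairwise row differences, `∑_{j < j'} 1_{b_j ≠ b_{j'}}`. -/
def pairwisePen {p m : ℕ} (B : Matrix (Fin p) (Fin m) ℝ) : ℝ :=
  ∑ j : Fin p, ∑ j' : Fin p, if j < j' ∧ B.row j ≠ B.row j' then 1 else 0

/-- The criterion `l₀(XB) + (λ²/2) ∑_{j < j'} 1_{b_j ≠ b_{j'}}`. -/
def pairwiseObjective {n p m : ℕ} (l : Matrix (Fin n) (Fin m) ℝ → ℝ)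
    (X : Matrix (Fin n) (Fin p) ℝ) (lam : ℝ) (B : Matrix (Fin p) (Fin m) ℝ) : ℝ :=
  l (X * B) + lam ^ 2 / 2 * pairwisePen B

/-- `λ_o = σ √((p ∨ m) / p)`. -/
def lambdaO (σ : ℝ) (p m : ℕ) : ℝ :=
  σ * Real.sqrt (max (p : ℝ) m / p)

/-- The complexity `P_o = {q ∧ rank(X) + m} r + (p - q) log q` of clustered reduced-rank learning
at `q = q(B)`, `r = rank(B)`. -/
def crlComplexity {n p m : ℕ} (X : Matrix (Fin n) (Fin p) ℝ) (B : Matrix (Fin p) (Fin m) ℝ) : ℝ :=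
  (min (numGroups B : ℝ) X.rank + m) * B.rank
    + ((p : ℝ) - numGroups B) * Real.log (numGroups B)

end PairwiseL0

end

noncomputable section

namespace PairwiseL0

/-! ### Combinatorics of groups of equal rows. -/

section Clusters

variable {p m : ℕ} (B : Matrix (Fin p) (Fin m) ℝ)

/-! Write ρ = (m ∨ p)/p and M = K ∨ (1/δ). Comparing the objective at B̂ and B* and inserting the
curvature condition (`basic_inequality`) bounds δ‖XB̂ - XB*‖²/2 by the noise term ⟨E, XB̂ - XB*⟩
plus penalties. The noise must be controlled uniformly over B, since B̂ depends on it.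

If B has q groups and B* has r, then XB - XB* lies in a subspace of dimension at most (q + r)m,
determined by two labellings of the rows. A sub-Gaussian vector projected to d dimensions satisfies
𝔼 exp(‖Pξ‖²/(2σ²)) ≤ 2·√2^d (`lintegral_exp_sum_sq_inner_le`). A weighted sum of these moments over
all labellings of the rows of B gives one random variable Z with 𝔼Z ≤ 2 and ⟨E, XB - XB*⟩² ≤
2σ²(level(q) + Z)‖XB - XB*‖² for every B (`IsSubGaussianNoise.exists_uniform_bound`).

The level is of order (q + r)m + pq. The bound p(q - 1)/2 ≤ 𝒞(B) (`le_clusterPen`) turns it into a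
multiple of m + ρ𝒞(B) + ρ𝒞(B*). For large A the penalty λ²𝒞(B̂)/2 absorbs every 𝒞(B̂) term
(`sq_error_le`), and the expectation leaves the stated rate. The same lower bound on 𝒞 gives the
comparison with CRL; Cauchy–Schwarz on group sizes gives the explicit upper bound. -/

theorem row_mem_distinctRows (j : Fin p) : B.row j ∈ distinctRows B :=
  Finset.mem_image_of_mem _ (Finset.mem_univ j)

/-- Summing over the rows of a matrix is summing over its distinct rows with multiplicity. -/
theorem sum_groupSize_mul (φ : (Fin m → ℝ) → ℝ) :
    ∑ v ∈ distinctRows B, (groupSize B v : ℝ) * φ v = ∑ j, φ (B.row j) := by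
  rw [← Finset.sum_fiberwise_of_maps_to (s := Finset.univ) (t := distinctRows B)
    (g := fun j => B.row j) (fun j _ => row_mem_distinctRows B j)]
  refine Finset.sum_congr rfl fun v _ => ?_
  rw [Finset.sum_congr rfl (g := fun _ => φ v)
    (fun j hj => by rw [(Finset.mem_filter.mp hj).2])]
  simp [groupSize]

theorem sum_groupSize : ∑ v ∈ distinctRows B, (groupSize B v : ℝ) = p := by
  simpa using sum_groupSize_mul B fun _ => 1

theorem one_le_groupSize {v : Fin m → ℝ} (hv : v ∈ distinctRows B) : 1 ≤ groupSize B v := by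
  obtain ⟨j, -, rfl⟩ := Finset.mem_image.mp hv
  exact Finset.card_pos.mpr ⟨j, by simp⟩

theorem numGroups_pos (hp : 0 < p) : 1 ≤ numGroups B :=
  Finset.card_pos.mpr ⟨_, row_mem_distinctRows B ⟨0, hp⟩⟩

theorem numGroups_le : numGroups B ≤ p := by
  simpa [numGroups, distinctRows] using
    (Finset.card_image_le (s := Finset.univ) (f := fun j => B.row j))

/-- The other q - 1 groups each contain at least one of the p rows. -/
theorem groupSize_add_numGroups_le {v : Fin m → ℝ} (hv : v ∈ distinctRows B) :
    (groupSize B v : ℝ) + numGroups B ≤ p + 1 := by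
  have h := Finset.add_sum_erase (distinctRows B) (fun v => (groupSize B v : ℝ)) hv
  rw [sum_groupSize] at h
  have h1 : ((distinctRows B).erase v).card • (1 : ℝ)
      ≤ ∑ w ∈ (distinctRows B).erase v, (groupSize B w : ℝ) :=
    Finset.card_nsmul_le_sum _ _ _ fun w hw => by
      exact_mod_cast one_le_groupSize B (Finset.mem_of_mem_erase hw)
  have h2 : (((distinctRows B).erase v).card : ℝ) + 1 = numGroups B := by
    exact_mod_cast Finset.card_erase_add_one hv
  rw [nsmul_eq_mul, mul_one] at h1
  linarith

theorem clusterPen_eq_sub :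
    clusterPen B = ((p : ℝ) ^ 2 - ∑ v ∈ distinctRows B, (groupSize B v : ℝ) ^ 2) / 2 := by
  have h : ∑ v ∈ distinctRows B, (groupSize B v : ℝ) * p = (p : ℝ) ^ 2 := by
    rw [← Finset.sum_mul, sum_groupSize, sq]
  simp only [clusterPen, mul_sub, Finset.sum_sub_distrib, h, sq (groupSize B _ : ℝ)]
  ring

/-- Every group has size at most p + 1 - q, so ∑ g² ≤ p(p + 1 - q). This is the link between the
penalty and the number of groups. -/
theorem le_clusterPen : (p : ℝ) * ((numGroups B : ℝ) - 1) / 2 ≤ clusterPen B := by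
  have h : ∑ v ∈ distinctRows B, (groupSize B v : ℝ) ^ 2
      ≤ ∑ v ∈ distinctRows B, (groupSize B v : ℝ) * ((p : ℝ) + 1 - numGroups B) := by
    refine Finset.sum_le_sum fun v hv => ?_
    rw [sq]
    have := groupSize_add_numGroups_le B hv
    gcongr
    linarith
  rw [← Finset.sum_mul, sum_groupSize] at h
  rw [clusterPen_eq_sub]
  linarith

theorem clusterPen_nonneg (hp : 0 < p) : 0 ≤ clusterPen B := by
  have h1 : (1 : ℝ) ≤ numGroups B := by exact_mod_cast numGroups_pos B hp
  exact le_trans (by have := sub_nonneg.mpr h1; positivity) (le_clusterPen B)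

theorem clusterPen_le (hp : 0 < p) :
    clusterPen B ≤ ((p : ℝ) ^ 2 - (p : ℝ) ^ 2 / numGroups B) / 2 := by
  have h1 : (0 : ℝ) < numGroups B := by exact_mod_cast numGroups_pos B hp
  have h := sq_sum_le_card_mul_sum_sq (s := distinctRows B) (f := fun v => (groupSize B v : ℝ))
  rw [sum_groupSize] at h
  have h2 : (p : ℝ) ^ 2 / numGroups B ≤ ∑ v ∈ distinctRows B, (groupSize B v : ℝ) ^ 2 := by
    rw [div_le_iff₀' h1]
    exact h
  rw [clusterPen_eq_sub]
  linarith

/-- Both count unequal pairs of rows: 𝒞 halves the ordered pairs, and swapping j with j' matches the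
two orders. -/
theorem pairwisePen_eq_clusterPen : pairwisePen B = clusterPen B := by
  have h1 : clusterPen B
      = 1 / 2 * ∑ j : Fin p, ∑ j' : Fin p, if B.row j ≠ B.row j' then (1 : ℝ) else 0 := by
    rw [clusterPen, sum_groupSize_mul B fun v => (p : ℝ) - groupSize B v]
    congr 1
    refine Finset.sum_congr rfl fun j _ => ?_
    have := Finset.card_filter_add_card_filter_not (s := Finset.univ)
      (fun j' : Fin p => B.row j' = B.row j)
    rw [Finset.sum_boole, sub_eq_iff_eq_add']
    simp only [groupSize, ne_comm (a := B.row j)]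
    rw [Finset.card_univ, Fintype.card_fin] at this
    exact_mod_cast this.symm
  have h2 : ∑ j : Fin p, ∑ j' : Fin p, (if B.row j ≠ B.row j' then (1 : ℝ) else 0)
      = pairwisePen B + ∑ j : Fin p, ∑ j' : Fin p,
          if j' < j ∧ B.row j' ≠ B.row j then (1 : ℝ) else 0 := by
    simp only [pairwisePen, ← Finset.sum_add_distrib]
    refine Finset.sum_congr rfl fun j _ => Finset.sum_congr rfl fun j' _ => ?_
    rcases lt_trichotomy j j' with h | rfl | h
    · simp [h, h.not_gt]
    · simp
    · simp [h, h.not_gt, eq_comm (a := B.row j)]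
  rw [Finset.sum_comm (f := fun j j' : Fin p =>
    if j' < j ∧ B.row j' ≠ B.row j then (1 : ℝ) else 0)] at h2
  rw [h1, h2, pairwisePen]
  ring

theorem rank_le_numGroups : B.rank ≤ numGroups B := by
  rw [Matrix.rank_eq_finrank_span_row]
  have h : Set.range B.row = (distinctRows B : Set (Fin m → ℝ)) := by
    simp [distinctRows]
  rw [h]
  exact finrank_span_finset_le_card _

/-- A matrix with `q` distinct rows factors through a labelling of its rows by `Fin q`. -/
theorem exists_labelling {q : ℕ} (hq : numGroups B = q) :
    ∃ (f : Fin p → Fin q) (u : Matrix (Fin q) (Fin m) ℝ), B = u.submatrix f id := by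
  subst hq
  let e : distinctRows B ≃ Fin (numGroups B) := (distinctRows B).equivFin
  refine ⟨fun j => e ⟨B.row j, row_mem_distinctRows B j⟩, Matrix.of fun i => (e.symm i).1, ?_⟩
  ext i j
  simp [Matrix.row]

variable {n : ℕ} (X : Matrix (Fin n) (Fin p) ℝ)

theorem crlComplexity_add_one_le (hp : 0 < p) (hm : 0 < m) :
    crlComplexity X B + 1 ≤ 6 * ((m : ℝ) + max (m : ℝ) p / p * clusterPen B) := by
  set q : ℝ := (numGroups B : ℝ) with hq
  set N : ℝ := max (m : ℝ) p
  have hp' : (0 : ℝ) < p := by exact_mod_cast hp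
  have hm' : (1 : ℝ) ≤ m := by exact_mod_cast hm
  have hq1 : 1 ≤ q := by rw [hq]; exact_mod_cast numGroups_pos B hp
  have hrq : (B.rank : ℝ) ≤ q := by rw [hq]; exact_mod_cast rank_le_numGroups B
  have hrm : (B.rank : ℝ) ≤ m := by exact_mod_cast B.rank_le_width
  have hr0 : (0 : ℝ) ≤ B.rank := by positivity
  have hmN : (m : ℝ) ≤ N := le_max_left _ _
  have hpN : (p : ℝ) ≤ N := le_max_right _ _
  have hC : N * (q - 1) / 2 ≤ N / p * clusterPen B := by
    calc N * (q - 1) / 2 = N / p * (p * (q - 1) / 2) := by field_simp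
      _ ≤ _ := by
        have : 0 ≤ N := by linarith
        gcongr
        exact le_clusterPen B
  have hlog : Real.log q ≤ q - 1 := Real.log_le_sub_one_of_pos (by linarith)
  have hlog0 : 0 ≤ Real.log q := Real.log_nonneg hq1
  have h1 : (min q (X.rank : ℝ) + m) * B.rank ≤ 2 * (q * m) := by
    have : (min q (X.rank : ℝ) + m) * B.rank ≤ (q + m) * B.rank := by
      gcongr
      exact min_le_left _ _
    nlinarith
  -- With `h1` and `h3` the complexity is at most 2m + 3N(q - 1), and N(q - 1) is at most twice the
  -- penalty term; hence the factor 6.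
  have h2 : ((p : ℝ) - q) * Real.log q ≤ N * (q - 1) :=
    mul_le_mul (by linarith) hlog hlog0 (by linarith)
  have h3 : q * m ≤ m + N * (q - 1) := by nlinarith
  rw [crlComplexity, ← hq]
  have : 0 ≤ N * (q - 1) := mul_nonneg (by linarith) (by linarith)
  linarith

theorem rate_le (hp : 0 < p) :
    max (m : ℝ) p / p * clusterPen B ≤ max (m : ℝ) p * ((p : ℝ) - (p : ℝ) / numGroups B) := by
  have hp' : (0 : ℝ) < p := by exact_mod_cast hp
  have hC := clusterPen_le B hp
  have hC0 := clusterPen_nonneg B hp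
  rw [div_mul_eq_mul_div, mul_div_assoc]
  refine mul_le_mul_of_nonneg_left ?_ (by positivity)
  rw [div_le_iff₀ hp']
  have : ((p : ℝ) - (p : ℝ) / numGroups B) * p = (p : ℝ) ^ 2 - (p : ℝ) ^ 2 / numGroups B := by
    ring
  rw [this]
  linarith

end Clusters

/-! ### Exponential moments of standard Gaussian vectors. -/

section GaussianIntegrals

open ProbabilityTheory

theorem integral_exp_sq_div_four_gaussianReal :
    ∫ x, Real.exp (x ^ 2 / 4) ∂(gaussianReal 0 1) = √2 := by
  rw [integral_gaussianReal_eq_integral_smul one_ne_zero]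
  have h : ∀ x : ℝ, gaussianPDFReal 0 1 x • Real.exp (x ^ 2 / 4)
      = (√(2 * Real.pi))⁻¹ * Real.exp (-(1 / 4) * x ^ 2) := fun x => by
    simp only [gaussianPDFReal, smul_eq_mul, mul_assoc, ← Real.exp_add, NNReal.coe_one, sub_zero,
      mul_one]
    ring_nf
  simp_rw [h]
  rw [integral_const_mul, integral_gaussian, ← Real.sqrt_inv,
    ← Real.sqrt_mul (by positivity)]
  congr 1
  field_simp
  norm_num

theorem lintegral_prod_gaussian {d : ℕ} (h : Fin d → ℝ → ℝ) (h0 : ∀ i x, 0 ≤ h i x)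
    (hi : ∀ i, Integrable (h i) (gaussianReal 0 1)) :
    ∫⁻ g, ENNReal.ofReal (∏ i, h i (g i)) ∂(Measure.pi fun _ : Fin d => gaussianReal 0 1)
      = ENNReal.ofReal (∏ i, ∫ x, h i x ∂(gaussianReal 0 1)) := by
  rw [← integral_fintype_prod_eq_prod, ofReal_integral_eq_lintegral_ofReal]
  · exact Integrable.fintype_prod_dep hi
  · exact Filter.Eventually.of_forall fun g => Finset.prod_nonneg fun i _ => h0 i _

theorem lintegral_exp_linear_gaussian {d : ℕ} (v : Fin d → ℝ) :
    ∫⁻ g, ENNReal.ofReal (Real.exp (∑ i, v i * g i))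
        ∂(Measure.pi fun _ : Fin d => gaussianReal 0 1)
      = ENNReal.ofReal (Real.exp ((∑ i, v i ^ 2) / 2)) := by
  simp_rw [Real.exp_sum]
  rw [lintegral_prod_gaussian (fun i x => Real.exp (v i * x)) (fun _ _ => (Real.exp_pos _).le)
    (fun i => integrable_exp_mul_gaussianReal _), Finset.sum_div, Real.exp_sum]
  congr 1
  refine Finset.prod_congr rfl fun i _ => ?_
  have := mgf_gaussianReal (p := gaussianReal 0 1) (X := id) Measure.map_id (v i)
  simpa [mgf] using this

theorem lintegral_exp_sq_gaussian (d : ℕ) :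
    ∫⁻ g, ENNReal.ofReal (Real.exp ((∑ i, g i ^ 2) / 4))
        ∂(Measure.pi fun _ : Fin d => gaussianReal 0 1)
      = ENNReal.ofReal (√2 ^ d) := by
  simp_rw [Finset.sum_div, Real.exp_sum]
  rw [lintegral_prod_gaussian (fun _ x => Real.exp (x ^ 2 / 4)) (fun _ _ => (Real.exp_pos _).le)]
  · simp [integral_exp_sq_div_four_gaussianReal]
  · refine fun _ => Integrable.of_integral_ne_zero ?_
    rw [integral_exp_sq_div_four_gaussianReal]
    positivity

end GaussianIntegrals

/-! ### Projections of sub-Gaussian vectors to subspaces. -/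

section SubGaussianVectors

open ProbabilityTheory

variable {Ω F : Type*} [MeasurableSpace Ω] {μ : Measure Ω}
  [NormedAddCommGroup F] [InnerProductSpace ℝ F] {ξ : Ω → F} {σ : ℝ}

/-- Linearising the square by an independent Gaussian vector: the squared length of the
projection of a sub-Gaussian vector to `d` orthonormal directions has an exponential moment
of order `√2 ^ d`. -/
theorem lintegral_exp_sum_sq_inner_le [SFinite μ] (hσ : 0 < σ)
    (hmeas : ∀ α : F, AEMeasurable (fun ω => inner ℝ (ξ ω) α) μ)
    (hmgf : ∀ α : F, ∫⁻ ω, ENNReal.ofReal (Real.exp (inner ℝ (ξ ω) α)) ∂μ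
      ≤ 2 * ENNReal.ofReal (Real.exp (σ ^ 2 * ‖α‖ ^ 2 / 4)))
    {d : ℕ} {e : Fin d → F} (he : Orthonormal ℝ e) :
    ∫⁻ ω, ENNReal.ofReal (Real.exp ((∑ i, inner ℝ (ξ ω) (e i) ^ 2) / (2 * σ ^ 2))) ∂μ
      ≤ 2 * ENNReal.ofReal (√2 ^ d) := by
  have h1 : ∀ ω, ENNReal.ofReal (Real.exp ((∑ i, inner ℝ (ξ ω) (e i) ^ 2) / (2 * σ ^ 2)))
      = ∫⁻ g, ENNReal.ofReal (Real.exp (∑ i, inner ℝ (ξ ω) (e i) / σ * g i))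
        ∂(Measure.pi fun _ : Fin d => gaussianReal 0 1) := fun ω => by
    rw [lintegral_exp_linear_gaussian]
    simp_rw [div_pow, ← Finset.sum_div]
    congr 2
    field_simp
  simp_rw [h1]
  rw [lintegral_lintegral_swap]
  · calc _ ≤ ∫⁻ g, 2 * ENNReal.ofReal (Real.exp ((∑ i, g i ^ 2) / 4))
          ∂(Measure.pi fun _ : Fin d => gaussianReal 0 1) := by
          refine lintegral_mono fun g => ?_
          -- For fixed g the integrand is the exponential of ξ paired with this vector, whose
          -- squared norm is |g|²/σ² by orthonormality.
          have h2 := hmgf (∑ i, (g i / σ) • e i)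
          have h3 : ‖∑ i, (g i / σ) • e i‖ ^ 2 = (∑ i, g i ^ 2) / σ ^ 2 := by
            rw [← real_inner_self_eq_norm_sq, he.inner_sum]
            simp [Finset.sum_div, div_pow, ← sq]
          rw [h3] at h2
          simp_rw [inner_sum, real_inner_smul_right] at h2
          convert h2 using 5
          · refine Finset.sum_congr rfl fun i _ => ?_
            ring
          · field_simp
      _ = _ := by
          rw [lintegral_const_mul' _ _ (by simp), lintegral_exp_sq_gaussian]
  · refine (Real.measurable_exp.comp_aemeasurable ?_).ennreal_ofReal
    refine Finset.aemeasurable_fun_sum _ fun i _ => ?_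
    refine AEMeasurable.mul ?_ ?_
    · exact ((hmeas (e i)).div_const σ).comp_fst
    · exact ((measurable_pi_apply i).comp measurable_snd).aemeasurable

variable [FiniteDimensional ℝ F]

/-- The squared length of the projection of `x` to the subspace `V`. -/
def projSq (V : Submodule ℝ F) (x : F) : ℝ :=
  ∑ i, inner ℝ x (stdOrthonormalBasis ℝ V i : F) ^ 2

theorem sq_inner_le_projSq_mul (V : Submodule ℝ F) (x : F) {v : F} (hv : v ∈ V) :
    inner ℝ x v ^ 2 ≤ projSq V x * ‖v‖ ^ 2 := by
  set b := stdOrthonormalBasis ℝ V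
  have h1 : inner ℝ x v = ∑ i, inner ℝ x (b i : F) * inner ℝ (b i) (⟨v, hv⟩ : V) := by
    have h := congrArg (fun w : V => inner ℝ x (w : F)) (b.sum_repr' ⟨v, hv⟩)
    simp only [Submodule.coe_sum, inner_sum, Submodule.coe_smul, real_inner_smul_right] at h
    rw [← h]
    exact Finset.sum_congr rfl fun i _ => mul_comm _ _
  have h2 : ∑ i, inner ℝ (b i) (⟨v, hv⟩ : V) ^ 2 = ‖v‖ ^ 2 := by
    simpa using b.sum_sq_norm_inner_right (⟨v, hv⟩ : V)
  rw [h1, ← h2]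
  exact Finset.sum_mul_sq_le_sq_mul_sq _ _ _

/-- Uniform control of a sub-Gaussian vector over a finite family of subspaces, with an arbitrary
choice of levels `L k`. -/
theorem exists_integrable_sq_inner_le [SFinite μ] (hσ : 0 < σ)
    (hmeas : ∀ α : F, AEMeasurable (fun ω => inner ℝ (ξ ω) α) μ)
    (hmgf : ∀ α : F, ∫⁻ ω, ENNReal.ofReal (Real.exp (inner ℝ (ξ ω) α)) ∂μ
      ≤ 2 * ENNReal.ofReal (Real.exp (σ ^ 2 * ‖α‖ ^ 2 / 4)))
    {κ : Type*} [Fintype κ] (V : κ → Submodule ℝ F) (L : κ → ℝ) :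
    ∃ Z : Ω → ℝ, Integrable Z μ ∧ (∀ ω, 0 ≤ Z ω) ∧
      ∫ ω, Z ω ∂μ ≤ ∑ k, 2 * √2 ^ (Module.finrank ℝ (V k)) * Real.exp (-L k) ∧
      ∀ ω k, ∀ v ∈ V k, inner ℝ (ξ ω) v ^ 2 ≤ 2 * σ ^ 2 * (L k + Z ω) * ‖v‖ ^ 2 := by
  have hm : ∀ k, AEMeasurable (fun ω => projSq (V k) (ξ ω)) μ := fun k =>
    Finset.aemeasurable_fun_sum _ fun i _ => (hmeas _).pow_const 2
  have hint : ∀ k, ∫⁻ ω, ENNReal.ofReal (Real.exp (projSq (V k) (ξ ω) / (2 * σ ^ 2))) ∂μ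
      ≤ ENNReal.ofReal (2 * √2 ^ (Module.finrank ℝ (V k))) := fun k => by
    have he : Orthonormal ℝ fun i => (stdOrthonormalBasis ℝ (V k) i : F) :=
      (stdOrthonormalBasis ℝ (V k)).orthonormal.comp_linearIsometry (V k).subtypeₗᵢ
    rw [ENNReal.ofReal_mul (by norm_num)]
    simpa [projSq] using lintegral_exp_sum_sq_inner_le hσ hmeas hmgf he
  have hi : ∀ k, Integrable (fun ω => Real.exp (projSq (V k) (ξ ω) / (2 * σ ^ 2))) μ := fun k => by
    refine ⟨(Real.measurable_exp.comp_aemeasurable ((hm k).div_const _)).aestronglyMeasurable, ?_⟩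
    rw [hasFiniteIntegral_iff_ofReal (Filter.Eventually.of_forall fun _ => (Real.exp_pos _).le)]
    exact (hint k).trans_lt ENNReal.ofReal_lt_top
  -- By x ≤ exp x, each excess projSq/(2σ²) - L k is at most its own summand, hence at most Z. The
  -- union bound thus holds directly in expectation.
  refine ⟨fun ω => ∑ k, Real.exp (projSq (V k) (ξ ω) / (2 * σ ^ 2)) * Real.exp (-L k),
    integrable_finsetSum _ fun k _ => (hi k).mul_const _,
    fun ω => Finset.sum_nonneg fun k _ => by positivity, ?_, fun ω k v hv => ?_⟩
  · rw [integral_finsetSum _ fun k _ => (hi k).mul_const _]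
    refine Finset.sum_le_sum fun k _ => ?_
    rw [integral_mul_const]
    refine mul_le_mul_of_nonneg_right ?_ (Real.exp_pos _).le
    rw [integral_eq_lintegral_of_nonneg_ae
      (Filter.Eventually.of_forall fun _ => (Real.exp_pos _).le) (hi k).aestronglyMeasurable]
    exact ENNReal.toReal_le_of_le_ofReal (by positivity) (hint k)
  · refine (sq_inner_le_projSq_mul (V k) (ξ ω) hv).trans ?_
    refine mul_le_mul_of_nonneg_right ?_ (sq_nonneg _)
    have h1 : projSq (V k) (ξ ω) / (2 * σ ^ 2) - L k
        ≤ ∑ k, Real.exp (projSq (V k) (ξ ω) / (2 * σ ^ 2)) * Real.exp (-L k) := by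
      refine le_trans ?_ (Finset.single_le_sum (fun k _ => by positivity) (Finset.mem_univ k))
      rw [← Real.exp_add, ← sub_eq_add_neg]
      linarith [Real.add_one_le_exp (projSq (V k) (ξ ω) / (2 * σ ^ 2) - L k)]
    rw [← div_le_iff₀' (by positivity)]
    linarith

end SubGaussianVectors

/-! ### Consequences of a bound on the ψ₂ norm. -/

section OrliczNorm

variable {Ω : Type*} [MeasurableSpace Ω] {μ : Measure Ω} {Z : Ω → ℝ} {s : ℝ}

theorem exists_lintegral_exp_sq_le_two (h : psi2Norm μ Z ≤ ENNReal.ofReal s) (hs : 0 ≤ s)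
    {r : ℝ} (hr : s < r) :
    ∃ t : ℝ, 0 < t ∧ t < r ∧ ∫⁻ ω, ENNReal.ofReal (Real.exp ((Z ω / t) ^ 2)) ∂μ ≤ 2 := by
  have h1 : psi2Norm μ Z < ENNReal.ofReal r :=
    h.trans_lt ((ENNReal.ofReal_lt_ofReal_iff (hs.trans_lt hr)).mpr hr)
  simp only [psi2Norm, iInf_lt_iff] at h1
  obtain ⟨t, ⟨ht0, ht⟩, htr⟩ := h1
  refine ⟨t, ht0, ?_, ht⟩
  rw [← ENNReal.ofReal_coe_nnreal] at htr
  exact (ENNReal.ofReal_lt_ofReal_iff_of_nonneg t.2).mp htr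

/-- Young's inequality z ≤ (z/t)² + t²/4; the factor 2 is the one in the definition of the norm. -/
theorem lintegral_exp_le_of_psi2Norm_le (h : psi2Norm μ Z ≤ ENNReal.ofReal s) (hs : 0 ≤ s) :
    ∫⁻ ω, ENNReal.ofReal (Real.exp (Z ω)) ∂μ ≤ 2 * ENNReal.ofReal (Real.exp (s ^ 2 / 4)) := by
  -- The infimum supplies an admissible t only below each r > s, so r is sent down to s at the end.
  have hbound : ∀ r, s < r →
      ∫⁻ ω, ENNReal.ofReal (Real.exp (Z ω)) ∂μ ≤ 2 * ENNReal.ofReal (Real.exp (r ^ 2 / 4)) := by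
    intro r hr
    obtain ⟨t, ht0, htr, ht⟩ := exists_lintegral_exp_sq_le_two h hs hr
    calc _ ≤ ∫⁻ ω, ENNReal.ofReal (Real.exp ((Z ω / t) ^ 2))
            * ENNReal.ofReal (Real.exp (r ^ 2 / 4)) ∂μ := by
          refine lintegral_mono fun ω => ?_
          rw [← ENNReal.ofReal_mul (Real.exp_pos _).le, ← Real.exp_add]
          refine ENNReal.ofReal_le_ofReal (Real.exp_le_exp.mpr ?_)
          have h1 : Z ω = Z ω / t * t := by field_simp
          nlinarith [sq_nonneg (Z ω / t - t / 2)]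
      _ ≤ _ := by
          rw [lintegral_mul_const' _ _ ENNReal.ofReal_ne_top]
          gcongr
  have hlim : Filter.Tendsto (fun r : ℝ => 2 * ENNReal.ofReal (Real.exp (r ^ 2 / 4)))
      (nhdsWithin s (Set.Ioi s)) (nhds (2 * ENNReal.ofReal (Real.exp (s ^ 2 / 4)))) := by
    refine ENNReal.Tendsto.const_mul ?_ (Or.inr (by simp))
    refine (ENNReal.continuous_ofReal.tendsto _).comp ?_
    exact (Continuous.tendsto (by fun_prop) s).mono_left nhdsWithin_le_nhds
  exact ge_of_tendsto hlim (Filter.eventually_of_mem self_mem_nhdsWithin hbound)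

/-- Since z² ≤ t² exp((z/t)²), the second moment is at most 2r² for every r > 0. This serves the
degenerate case σ = 0. -/
theorem ae_eq_zero_of_psi2Norm_le_zero (hZ : AEMeasurable Z μ) (h : psi2Norm μ Z ≤ 0) :
    ∀ᵐ ω ∂μ, Z ω = 0 := by
  have hbound : ∀ r : ℝ, 0 < r →
      ∫⁻ ω, ENNReal.ofReal (Z ω ^ 2) ∂μ ≤ 2 * ENNReal.ofReal (r ^ 2) := by
    intro r hr
    obtain ⟨t, ht0, htr, ht⟩ := exists_lintegral_exp_sq_le_two (s := 0) (by simpa using h) le_rfl hr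
    calc _ ≤ ∫⁻ ω, ENNReal.ofReal (Real.exp ((Z ω / t) ^ 2)) * ENNReal.ofReal (r ^ 2) ∂μ := by
          refine lintegral_mono fun ω => ?_
          rw [← ENNReal.ofReal_mul (Real.exp_pos _).le]
          refine ENNReal.ofReal_le_ofReal ?_
          have h1 : Z ω ^ 2 = (Z ω / t) ^ 2 * t ^ 2 := by field_simp
          rw [h1]
          have := Real.add_one_le_exp ((Z ω / t) ^ 2)
          gcongr
          linarith
      _ ≤ _ := by
          rw [lintegral_mul_const' _ _ ENNReal.ofReal_ne_top]
          gcongr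
  have hlim : Filter.Tendsto (fun r : ℝ => 2 * ENNReal.ofReal (r ^ 2))
      (nhdsWithin 0 (Set.Ioi 0)) (nhds (2 * ENNReal.ofReal (0 ^ 2))) := by
    refine ENNReal.Tendsto.const_mul ?_ (Or.inr (by simp))
    refine (ENNReal.continuous_ofReal.tendsto _).comp ?_
    exact (Continuous.tendsto (by fun_prop) 0).mono_left nhdsWithin_le_nhds
  have h0 : ∫⁻ ω, ENNReal.ofReal (Z ω ^ 2) ∂μ = 0 := by
    simpa using ge_of_tendsto hlim (Filter.eventually_of_mem self_mem_nhdsWithin hbound)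
  rw [lintegral_eq_zero_iff' (hZ.pow_const 2).ennreal_ofReal] at h0
  filter_upwards [h0] with ω hω
  have h2 : Z ω ^ 2 ≤ 0 := by simpa using hω
  exact pow_eq_zero_iff two_ne_zero |>.mp (le_antisymm h2 (sq_nonneg _))

end OrliczNorm

/-! ### Matrices as Euclidean vectors, and the subspaces attached to labellings. -/

section Vectorization

variable {n p m : ℕ}

/-- A matrix as a vector of a Euclidean space. -/
def frobVec (n m : ℕ) : Matrix (Fin n) (Fin m) ℝ →ₗ[ℝ] EuclideanSpace ℝ (Fin n × Fin m) where
  toFun A := WithLp.toLp 2 fun ij => A ij.1 ij.2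
  map_add' _ _ := rfl
  map_smul' _ _ := rfl

theorem frobVec_apply (A : Matrix (Fin n) (Fin m) ℝ) (ij : Fin n × Fin m) :
    frobVec n m A ij = A ij.1 ij.2 := rfl

theorem inner_frobVec (A B : Matrix (Fin n) (Fin m) ℝ) :
    inner ℝ (frobVec n m A) (frobVec n m B) = frobInner A B := by
  simp [frobVec_apply, frobInner, PiLp.inner_apply, Fintype.sum_prod_type, mul_comm]

theorem norm_frobVec (A : Matrix (Fin n) (Fin m) ℝ) : ‖frobVec n m A‖ = ‖A‖ := by
  rw [EuclideanSpace.norm_eq, Matrix.frobenius_norm_def, Real.sqrt_eq_rpow]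
  simp [frobVec_apply, Fintype.sum_prod_type]

theorem frobVec_surjective : Function.Surjective (frobVec n m) :=
  fun α => ⟨Matrix.of fun i j => α (i, j), rfl⟩

/-- The differences of two matrices `X B`, `X B'` where the equal rows of `B` and of `B'` are
prescribed by the labellings `f` and `g`. -/
def labelledSpan (X : Matrix (Fin n) (Fin p) ℝ) (m : ℕ) {q r : ℕ} (f : Fin p → Fin q)
    (g : Fin p → Fin r) : Submodule ℝ (EuclideanSpace ℝ (Fin n × Fin m)) :=
  LinearMap.range (frobVec n m ∘ₗ
    ({ toFun := fun u => X * u.1.submatrix f id - X * u.2.submatrix g id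
       map_add' := fun u w => by
        simp only [Prod.fst_add, Prod.snd_add, Matrix.submatrix_add, Pi.add_apply, Matrix.mul_add]
        abel
       map_smul' := fun a u => by
        simp [Matrix.submatrix_smul, smul_sub] } :
      Matrix (Fin q) (Fin m) ℝ × Matrix (Fin r) (Fin m) ℝ →ₗ[ℝ] Matrix (Fin n) (Fin m) ℝ))

theorem finrank_labelledSpan_le (X : Matrix (Fin n) (Fin p) ℝ) (m : ℕ) {q r : ℕ}
    (f : Fin p → Fin q) (g : Fin p → Fin r) :
    Module.finrank ℝ (labelledSpan X m f g) ≤ (q + r) * m := by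
  refine (LinearMap.finrank_range_le _).trans ?_
  simp [Module.finrank_matrix, add_mul]

theorem frobVec_mem_labelledSpan (X : Matrix (Fin n) (Fin p) ℝ) {q r : ℕ} (f : Fin p → Fin q)
    (g : Fin p → Fin r) (u : Matrix (Fin q) (Fin m) ℝ) (w : Matrix (Fin r) (Fin m) ℝ) :
    frobVec n m (X * u.submatrix f id - X * w.submatrix g id) ∈ labelledSpan X m f g :=
  ⟨(u, w), rfl⟩

end Vectorization

/-! ### Uniform control of the noise over all clusterings. -/

section Noise

variable {n p m : ℕ} {Ω : Type*} [MeasurableSpace Ω] {μ : Measure Ω}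
  {E : Ω → Matrix (Fin n) (Fin m) ℝ} {σ : ℝ}

theorem IsSubGaussianNoise.aemeasurable_frobInner (hE : IsSubGaussianNoise μ E σ)
    (α : Matrix (Fin n) (Fin m) ℝ) : AEMeasurable (fun ω => frobInner (E ω) α) μ :=
  Finset.aemeasurable_fun_sum _ fun i _ => Finset.aemeasurable_fun_sum _ fun j _ =>
    (hE.aemeasurable i j).mul_const _

theorem IsSubGaussianNoise.ae_eq_zero (hE : IsSubGaussianNoise μ E 0) :
    ∀ᵐ ω ∂μ, E ω = 0 := by
  have h : ∀ i j, ∀ᵐ ω ∂μ, E ω i j = 0 := fun i j => by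
    have h1 := ae_eq_zero_of_psi2Norm_le_zero
      (hE.aemeasurable_frobInner (Matrix.single i j 1)) (by simpa using hE.psi2_le _)
    filter_upwards [h1] with ω hω
    simpa [frobInner, Matrix.single_apply, ite_and] using hω
  filter_upwards [ae_all_iff.mpr fun i => ae_all_iff.mpr (h i)] with ω hω
  ext i j
  exact hω i j

/-- The complexity of matrices with `q` distinct rows, seen from one with `r` distinct rows. -/
def labelLevel (p m r q : ℕ) : ℝ := ((q : ℝ) + r) * m + p * ((q : ℝ) - 1) + q

/-- The three terms of `labelLevel` pay, in order, for the factor √2^dim, for the (q + 1)^p ≤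
exp(pq) labellings, and for a geometric series in q. Here q + 1 is the number of labels. -/
theorem sum_labelLevel_le (X : Matrix (Fin n) (Fin p) ℝ) (m : ℕ) {r : ℕ} (g : Fin p → Fin r) :
    ∑ k : (Σ q : Fin p, (Fin p → Fin (q + 1))),
      2 * √2 ^ (Module.finrank ℝ (labelledSpan X m k.2 g)) *
        Real.exp (-labelLevel p m r (k.1 + 1)) ≤ 2 := by
  rw [Fintype.sum_sigma]
  have hterm : ∀ q : Fin p, ∑ f : Fin p → Fin (q + 1),
      2 * √2 ^ (Module.finrank ℝ (labelledSpan X m f g)) *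
        Real.exp (-labelLevel p m r (q + 1)) ≤ (1 / 2) ^ (q : ℕ) := fun q => by
    have hexp1 : (2 : ℝ) ≤ Real.exp 1 := by linarith [Real.add_one_le_exp (1 : ℝ)]
    have hsqrt : √2 ≤ Real.exp 1 :=
      (Real.sqrt_le_left (by norm_num)).mpr (by nlinarith) |>.trans hexp1
    have hone : ∀ f : Fin p → Fin (q + 1),
        2 * √2 ^ (Module.finrank ℝ (labelledSpan X m f g)) *
          Real.exp (-labelLevel p m r (q + 1))
        ≤ 2 * Real.exp (-((p : ℝ) * q + (q + 1))) := fun f => by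
      have h1 : √2 ^ (Module.finrank ℝ (labelledSpan X m f g))
          ≤ Real.exp (((q : ℝ) + 1 + r) * m) := by
        calc √2 ^ (Module.finrank ℝ (labelledSpan X m f g))
            ≤ √2 ^ ((q + 1 + r) * m) :=
              pow_le_pow_right₀ (Real.one_le_sqrt.mpr (by norm_num))
                (finrank_labelledSpan_le X m f g)
          _ ≤ Real.exp 1 ^ ((q + 1 + r) * m) := by gcongr
          _ = _ := by rw [← Real.exp_nat_mul]; push_cast; ring_nf
      calc _ ≤ 2 * Real.exp (((q : ℝ) + 1 + r) * m) *
              Real.exp (-labelLevel p m r (q + 1)) := by gcongr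
        _ = _ := by
          rw [mul_assoc, ← Real.exp_add, labelLevel]
          push_cast
          ring_nf
    refine (Finset.sum_le_card_nsmul _ _ _ fun f _ => hone f).trans ?_
    have hcard : (((q : ℕ) + 1 : ℝ)) ^ p ≤ Real.exp ((p : ℝ) * q) := by
      rw [Real.exp_nat_mul]
      gcongr
      exact Real.add_one_le_exp _
    have hhalf : Real.exp (-((q : ℝ) + 1)) ≤ (1 / 2) ^ ((q : ℕ) + 1) := by
      rw [Real.exp_neg, one_div, inv_pow]
      refine inv_anti₀ (by positivity) ?_
      calc (2 : ℝ) ^ ((q : ℕ) + 1) ≤ Real.exp 1 ^ ((q : ℕ) + 1) := by gcongr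
        _ = _ := by rw [← Real.exp_nat_mul]; push_cast; ring_nf
    simp only [Finset.card_univ, Fintype.card_pi, Fintype.card_fin, Finset.prod_const,
      nsmul_eq_mul]
    push_cast
    calc ((q : ℝ) + 1) ^ p * (2 * Real.exp (-((p : ℝ) * q + (q + 1))))
        ≤ Real.exp ((p : ℝ) * q) * (2 * Real.exp (-((p : ℝ) * q + (q + 1)))) := by gcongr
      _ = 2 * Real.exp (-((q : ℝ) + 1)) := by
        rw [mul_left_comm, ← Real.exp_add]
        ring_nf
      _ ≤ 2 * (1 / 2) ^ ((q : ℕ) + 1) := by gcongr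
      _ = _ := by ring
  refine (Finset.sum_le_sum fun q _ => hterm q).trans ?_
  rw [Fin.sum_univ_eq_sum_range (fun q => (1 / 2 : ℝ) ^ q) p]
  exact sum_geometric_two_le p

/-- Control of the noise on `X B - X Bstar`, uniform in `B`, at the level given by the number of
distinct rows of `B`. -/
theorem IsSubGaussianNoise.exists_uniform_bound [SFinite μ] (hE : IsSubGaussianNoise μ E σ)
    (hσ : 0 < σ) (hp : 0 < p) (X : Matrix (Fin n) (Fin p) ℝ) (Bstar : Matrix (Fin p) (Fin m) ℝ) :
    ∃ Z : Ω → ℝ, Integrable Z μ ∧ (∀ ω, 0 ≤ Z ω) ∧ ∫ ω, Z ω ∂μ ≤ 2 ∧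
      ∀ ω, ∀ B : Matrix (Fin p) (Fin m) ℝ, frobInner (E ω) (X * B - X * Bstar) ^ 2
        ≤ 2 * σ ^ 2 * (labelLevel p m (numGroups Bstar) (numGroups B) + Z ω)
          * ‖X * B - X * Bstar‖ ^ 2 := by
  obtain ⟨g, w, hw⟩ := exists_labelling Bstar rfl
  have hmeas : ∀ α, AEMeasurable (fun ω => inner ℝ (frobVec n m (E ω)) α) μ := fun α => by
    obtain ⟨α, rfl⟩ := frobVec_surjective α
    simpa only [inner_frobVec] using hE.aemeasurable_frobInner α
  have hmgf : ∀ α, ∫⁻ ω, ENNReal.ofReal (Real.exp (inner ℝ (frobVec n m (E ω)) α)) ∂μ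
      ≤ 2 * ENNReal.ofReal (Real.exp (σ ^ 2 * ‖α‖ ^ 2 / 4)) := fun α => by
    obtain ⟨α, rfl⟩ := frobVec_surjective α
    simp only [inner_frobVec, norm_frobVec, ← mul_pow]
    exact lintegral_exp_le_of_psi2Norm_le (hE.psi2_le α) (by positivity)
  obtain ⟨Z, hZi, hZ0, hZ2, hZ⟩ := exists_integrable_sq_inner_le hσ hmeas hmgf
    (fun k : (Σ q : Fin p, (Fin p → Fin (q + 1))) => labelledSpan X m k.2 g)
    (fun k => labelLevel p m (numGroups Bstar) (k.1 + 1))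
  refine ⟨Z, hZi, hZ0, hZ2.trans (sum_labelLevel_le X m g), fun ω B => ?_⟩
  have h1 := numGroups_pos B hp
  -- The family is indexed by the number of groups minus one, an element of `Fin p`.
  obtain ⟨q, hq⟩ : ∃ q, numGroups B = q + 1 := ⟨numGroups B - 1, by omega⟩
  have hqp : q < p := by have := numGroups_le B; omega
  obtain ⟨f, u, hu⟩ := exists_labelling B hq
  have h := hZ ω ⟨⟨q, hqp⟩, f⟩ _ (frobVec_mem_labelledSpan X f g u w)
  rwa [← hu, ← hw, inner_frobVec, norm_frobVec, ← hq] at h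

/-- With N = m ∨ p the level is at most 3m + 3N(q - 1) + N(r - 1); then `le_clusterPen` is applied
to both matrices. -/
theorem labelLevel_le (hp : 0 < p) (hm : 0 < m) (B Bstar : Matrix (Fin p) (Fin m) ℝ) :
    labelLevel p m (numGroups Bstar) (numGroups B)
      ≤ 3 * m + 6 * (max (m : ℝ) p / p * clusterPen B)
        + 2 * (max (m : ℝ) p / p * clusterPen Bstar) := by
  set N : ℝ := max (m : ℝ) p
  have hp' : (0 : ℝ) < p := by exact_mod_cast hp
  have hm' : (1 : ℝ) ≤ m := by exact_mod_cast hm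
  have hmN : (m : ℝ) ≤ N := le_max_left _ _
  have hpN : (p : ℝ) ≤ N := le_max_right _ _
  have hC : ∀ B : Matrix (Fin p) (Fin m) ℝ,
      N * ((numGroups B : ℝ) - 1) / 2 ≤ N / p * clusterPen B := fun B => by
    calc N * ((numGroups B : ℝ) - 1) / 2 = N / p * (p * ((numGroups B : ℝ) - 1) / 2) := by
          field_simp
      _ ≤ _ := by
        have : 0 ≤ N := by linarith
        gcongr
        exact le_clusterPen B
  have h1 : (1 : ℝ) ≤ numGroups B := by exact_mod_cast numGroups_pos B hp
  have h2 : (1 : ℝ) ≤ numGroups Bstar := by exact_mod_cast numGroups_pos Bstar hp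
  have h3 := hC B
  have h4 := hC Bstar
  have h5 : (m : ℝ) * ((numGroups B : ℝ) - 1) ≤ N * ((numGroups B : ℝ) - 1) :=
    mul_le_mul_of_nonneg_right hmN (by linarith)
  have h6 : (m : ℝ) * ((numGroups Bstar : ℝ) - 1) ≤ N * ((numGroups Bstar : ℝ) - 1) :=
    mul_le_mul_of_nonneg_right hmN (by linarith)
  have h7 : (p : ℝ) * ((numGroups B : ℝ) - 1) ≤ N * ((numGroups B : ℝ) - 1) :=
    mul_le_mul_of_nonneg_right hpN (by linarith)
  have h8 : 1 * ((numGroups B : ℝ) - 1) ≤ N * ((numGroups B : ℝ) - 1) :=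
    mul_le_mul_of_nonneg_right (by linarith) (by linarith)
  rw [labelLevel]
  linarith

theorem labelLevel_nonneg {r q : ℕ} (hq : 1 ≤ q) : 0 ≤ labelLevel p m r q := by
  have : (0 : ℝ) ≤ (q : ℝ) - 1 := sub_nonneg.mpr (by exact_mod_cast hq)
  rw [labelLevel]
  positivity

end Noise

/-! ### From the basic inequality to the expected error. -/

section Estimator

variable {n p m : ℕ}

theorem neg_frobInner (A B : Matrix (Fin n) (Fin m) ℝ) : frobInner (-A) B = -frobInner A B := by
  simp [frobInner]

/-- Optimality and curvature bound the prediction error by the noise and the penalties. -/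
theorem basic_inequality {ψ : Matrix (Fin n) (Fin m) ℝ → ℝ} {X : Matrix (Fin n) (Fin p) ℝ}
    {B Bstar : Matrix (Fin p) (Fin m) ℝ} {δ κ lam : ℝ}
    (hcurv : δ * D2 (X * B) (X * Bstar)
      ≤ bregman ψ (X * B) (X * Bstar) + κ * clusterPen B + κ * clusterPen Bstar)
    (hopt : pairwiseObjective ψ X lam B ≤ pairwiseObjective ψ X lam Bstar) :
    δ * (‖X * B - X * Bstar‖ ^ 2 / 2)
      ≤ frobInner (-matGrad ψ (X * Bstar)) (X * B - X * Bstar)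
        + lam ^ 2 / 2 * (clusterPen Bstar - clusterPen B)
        + κ * (clusterPen B + clusterPen Bstar) := by
  simp only [D2, bregman, pairwiseObjective, pairwisePen_eq_clusterPen] at hcurv hopt
  rw [neg_frobInner]
  linarith

/-- AM–GM; the weight δ/4 leaves half of the curvature term δx²/2 on the left. -/
theorem le_quarter_of_sq_le {I a x δ : ℝ} (hδ : 0 < δ) (ha : 0 ≤ a) (h : I ^ 2 ≤ a * x ^ 2) :
    I ≤ δ / 4 * x ^ 2 + a / δ := by
  refine le_of_sq_le_sq ?_ (by positivity)
  have h1 : (δ / 4 * x ^ 2 + a / δ) ^ 2 = a * x ^ 2 + (δ / 4 * x ^ 2 - a / δ) ^ 2 := by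
    field_simp
    ring
  nlinarith [sq_nonneg (δ / 4 * x ^ 2 - a / δ)]

/-- In units of Mσ²ρ with M = K ∨ (1/δ), C has coefficient at most 12 from the noise, 1 from the
curvature and -A²/2 from the penalty. The total is negative once A ≥ 8, so C drops out. -/
theorem sq_error_le {x I L Z C Cs ρ m σ δ K A : ℝ} (hδ : 0 < δ) (hK : 0 ≤ K) (hA : 8 ≤ A)
    (hC : 0 ≤ C) (hCs : 0 ≤ Cs) (hρ : 0 ≤ ρ) (hL0 : 0 ≤ L) (hZ : 0 ≤ Z)
    (hL : L ≤ 3 * m + 6 * (ρ * C) + 2 * (ρ * Cs))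
    (hI : I ^ 2 ≤ 2 * σ ^ 2 * (L + Z) * x ^ 2)
    (h : δ * (x ^ 2 / 2) ≤ I + A ^ 2 * max K (1 / δ) * (σ ^ 2 * ρ) / 2 * (Cs - C)
      + K * (σ ^ 2 * ρ) * (C + Cs)) :
    x ^ 2 ≤ max (K * δ) 1 * σ ^ 2 / δ ^ 2 * (24 * m + 8 * Z + (2 * A ^ 2 + 20) * (ρ * Cs)) := by
  set M := max K (1 / δ) with hM
  have hMK : K ≤ M := le_max_left _ _
  have hMδ : 1 / δ ≤ M := le_max_right _ _
  have hM0 : 0 ≤ M := hK.trans hMK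
  have hR : max (K * δ) 1 * σ ^ 2 / δ ^ 2 = M * σ ^ 2 / δ := by
    have : max (K * δ) 1 = M * δ := by
      rw [hM, max_mul_of_nonneg _ _ hδ.le, one_div_mul_cancel hδ.ne']
    rw [this]
    field_simp
  have h1 := le_quarter_of_sq_le hδ (a := 2 * σ ^ 2 * (L + Z)) (by positivity) hI
  have h2 : 2 * σ ^ 2 * (L + Z) / δ
      ≤ 2 * σ ^ 2 * M * (3 * m + 6 * (ρ * C) + 2 * (ρ * Cs) + Z) := by
    calc 2 * σ ^ 2 * (L + Z) / δ = 2 * σ ^ 2 * (1 / δ) * (L + Z) := by ring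
      _ ≤ _ := by gcongr
  have h3 : K * (σ ^ 2 * ρ) * (C + Cs) ≤ M * (σ ^ 2 * ρ) * (C + Cs) := by gcongr
  have h4 : 64 * (M * (σ ^ 2 * ρ) * C) ≤ A ^ 2 * (M * (σ ^ 2 * ρ) * C) := by
    have : (64 : ℝ) ≤ A ^ 2 := by nlinarith
    gcongr
  have h5 : 0 ≤ M * (σ ^ 2 * ρ) * C := by positivity
  rw [hR, div_mul_eq_mul_div, le_div_iff₀ hδ]
  linarith

variable {Ω : Type*} [MeasurableSpace Ω] {μ : Measure Ω} [IsProbabilityMeasure μ]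

/-- The expected prediction error of a penalized estimator, for random losses `ψ ω`. -/
theorem integrable_and_integral_sq_error_le {A : ℝ} (hA : 8 ≤ A) (hp : 0 < p) (hm : 0 < m)
    {X : Matrix (Fin n) (Fin p) ℝ} {ψ : Ω → Matrix (Fin n) (Fin m) ℝ → ℝ}
    {Bstar : Matrix (Fin p) (Fin m) ℝ} {σ δ K : ℝ} (hσ : 0 ≤ σ) (hδ : 0 < δ) (hK : 0 ≤ K)
    (hE : IsSubGaussianNoise μ (fun ω => -matGrad (ψ ω) (X * Bstar)) σ)
    (hcurv : ∀ᵐ ω ∂μ, ∀ B₁ B₂ : Matrix (Fin p) (Fin m) ℝ,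
      δ * D2 (X * B₁) (X * B₂) ≤ bregman (ψ ω) (X * B₁) (X * B₂)
        + K * lambdaO σ p m ^ 2 * clusterPen B₁ + K * lambdaO σ p m ^ 2 * clusterPen B₂)
    {Bhat : Ω → Matrix (Fin p) (Fin m) ℝ}
    (hmeas : ∀ i j, AEMeasurable (fun ω => (X * Bhat ω) i j) μ)
    (hopt : ∀ᵐ ω ∂μ, ∀ B : Matrix (Fin p) (Fin m) ℝ,
      pairwiseObjective (ψ ω) X (A * √(max K (1 / δ)) * lambdaO σ p m) (Bhat ω)
        ≤ pairwiseObjective (ψ ω) X (A * √(max K (1 / δ)) * lambdaO σ p m) B) :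
    Integrable (fun ω => ‖X * Bhat ω - X * Bstar‖ ^ 2) μ ∧
    ∫ ω, ‖X * Bhat ω - X * Bstar‖ ^ 2 ∂μ ≤
      (2 * A ^ 2 + 40) * (max (K * δ) 1 * σ ^ 2 / δ ^ 2 *
        ((m : ℝ) + max (m : ℝ) p / p * clusterPen Bstar)) := by
  set ρ : ℝ := max (m : ℝ) p / p with hρ
  have hρ0 : 0 ≤ ρ := by positivity
  have hm1 : (1 : ℝ) ≤ m := by exact_mod_cast hm
  have hCs := clusterPen_nonneg Bstar hp
  have hlo : lambdaO σ p m ^ 2 = σ ^ 2 * ρ := by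
    rw [lambdaO, mul_pow, Real.sq_sqrt (by positivity), max_comm, hρ]
  have hlam : (A * √(max K (1 / δ)) * lambdaO σ p m) ^ 2
      = A ^ 2 * max K (1 / δ) * (σ ^ 2 * ρ) := by
    rw [mul_pow, mul_pow, hlo, Real.sq_sqrt (le_max_of_le_left hK)]
  have hbasic : ∀ᵐ ω ∂μ, δ * (‖X * Bhat ω - X * Bstar‖ ^ 2 / 2)
      ≤ frobInner (-matGrad (ψ ω) (X * Bstar)) (X * Bhat ω - X * Bstar)
        + A ^ 2 * max K (1 / δ) * (σ ^ 2 * ρ) / 2 * (clusterPen Bstar - clusterPen (Bhat ω))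
        + K * (σ ^ 2 * ρ) * (clusterPen (Bhat ω) + clusterPen Bstar) := by
    filter_upwards [hcurv, hopt] with ω h1 h2
    have := basic_inequality (h1 (Bhat ω) Bstar) (h2 Bstar)
    rwa [hlam, hlo] at this
  have hbound : ∃ Z : Ω → ℝ, Integrable Z μ ∧ ∫ ω, Z ω ∂μ ≤ 2 ∧
      ∀ᵐ ω ∂μ, ‖X * Bhat ω - X * Bstar‖ ^ 2 ≤ max (K * δ) 1 * σ ^ 2 / δ ^ 2 *
        (24 * m + 8 * Z ω + (2 * A ^ 2 + 20) * (ρ * clusterPen Bstar)) := by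
    -- For σ = 0 the uniform bound, which divides by σ, is unavailable; but noise and λ both vanish,
    -- so the error is zero almost surely.
    rcases hσ.eq_or_lt with rfl | hσ
    · refine ⟨0, integrable_zero _ _ _, by simp, ?_⟩
      filter_upwards [hbasic, hE.ae_eq_zero] with ω h1 h2
      have h3 : ‖X * Bhat ω - X * Bstar‖ ^ 2 * δ ≤ 0 := by
        rw [h2] at h1
        simp only [frobInner, Matrix.zero_apply, zero_mul, Finset.sum_const_zero] at h1
        linarith
      simpa using nonpos_of_mul_nonpos_left h3 hδ
    · obtain ⟨Z, hZi, hZ0, hZ2, hZ⟩ := hE.exists_uniform_bound hσ hp X Bstar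
      refine ⟨Z, hZi, hZ2, ?_⟩
      filter_upwards [hbasic] with ω h1
      exact sq_error_le hδ hK hA (clusterPen_nonneg _ hp) hCs hρ0
        (labelLevel_nonneg (numGroups_pos _ hp)) (hZ0 ω) (labelLevel_le hp hm _ _)
        (hZ ω (Bhat ω)) h1
  obtain ⟨Z, hZi, hZ2, hZ⟩ := hbound
  set R : ℝ := max (K * δ) 1 * σ ^ 2 / δ ^ 2
  have hR : 0 ≤ R := by positivity
  have hsum : Integrable (fun ω => 24 * (m : ℝ) + 8 * Z ω) μ :=
    (integrable_const _).add (hZi.const_mul 8)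
  have hmaj : Integrable (fun ω =>
      R * (24 * m + 8 * Z ω + (2 * A ^ 2 + 20) * (ρ * clusterPen Bstar))) μ :=
    (hsum.add (integrable_const _)).const_mul R
  have hsq : ∀ ω, ‖X * Bhat ω - X * Bstar‖ ^ 2
      = ∑ i, ∑ j, ((X * Bhat ω) i j - (X * Bstar) i j) ^ 2 := fun ω => by
    rw [← norm_frobVec, EuclideanSpace.norm_sq_eq, Fintype.sum_prod_type]
    simp [frobVec_apply]
  have hae : AEMeasurable (fun ω => ‖X * Bhat ω - X * Bstar‖ ^ 2) μ := by
    simp_rw [hsq]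
    exact Finset.aemeasurable_fun_sum _ fun i _ => Finset.aemeasurable_fun_sum _ fun j _ =>
      ((hmeas i j).sub_const _).pow_const 2
  have hint : Integrable (fun ω => ‖X * Bhat ω - X * Bstar‖ ^ 2) μ := by
    refine hmaj.mono' hae.aestronglyMeasurable ?_
    filter_upwards [hZ] with ω h
    rwa [Real.norm_of_nonneg (by positivity)]
  refine ⟨hint, (integral_mono_ae hint hmaj hZ).trans ?_⟩
  rw [integral_const_mul, integral_add hsum (integrable_const _),
    integral_add (integrable_const _) (hZi.const_mul 8), integral_const_mul 8 Z]
  simp only [integral_const, probReal_univ, one_smul]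
  rw [mul_left_comm (2 * A ^ 2 + 40)]
  refine mul_le_mul_of_nonneg_left ?_ hR
  -- Since 𝔼Z ≤ 2 and m ≥ 1, 24m + 8𝔼Z ≤ 40m, whence the 40 in the constant.
  have : 0 ≤ ρ * clusterPen Bstar := by positivity
  nlinarith [sq_nonneg A]

end Estimator

end PairwiseL0

end

open PairwiseL0 in
theorem theoremA3 :
    ∃ A₀ : ℝ, 0 < A₀ ∧ ∀ A : ℝ, A₀ ≤ A → ∃ c : ℝ, 0 < c ∧
      ∀ (n p m : ℕ) (_ : 0 < p) (_ : 0 < m)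
        (Ω : Type*) [MeasurableSpace Ω] (μ : Measure Ω) [IsProbabilityMeasure μ]
        (X : Matrix (Fin n) (Fin p) ℝ)
        (Y : Ω → Matrix (Fin n) (Fin m) ℝ)
        -- the loss `l₀ η y`, a function of the systematic component `η` and the response `y`
        (l₀ : Matrix (Fin n) (Fin m) ℝ → Matrix (Fin n) (Fin m) ℝ → ℝ)
        (_ : ∀ y, Differentiable ℝ fun η => l₀ η y)
        (Bstar : Matrix (Fin p) (Fin m) ℝ)
        (σ δ K : ℝ) (_ : 0 ≤ σ) (_ : 0 < δ) (_ : 0 ≤ K)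
        -- the effective noise `-∇l₀(XB*; Y)`
        (_ : IsSubGaussianNoise μ (fun ω => -matGrad (fun η => l₀ η (Y ω)) (X * Bstar)) σ)
        -- the curvature condition
        (_ : ∀ᵐ ω ∂μ, ∀ B₁ B₂ : Matrix (Fin p) (Fin m) ℝ,
          δ * D2 (X * B₁) (X * B₂) ≤
            bregman (fun η => l₀ η (Y ω)) (X * B₁) (X * B₂)
              + K * lambdaO σ p m ^ 2 * clusterPen B₁ + K * lambdaO σ p m ^ 2 * clusterPen B₂)
        -- the estimator, an optimal solution of the penalized problem
        (Bhat : Ω → Matrix (Fin p) (Fin m) ℝ)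
        (_ : ∀ i j, AEMeasurable (fun ω => (X * Bhat ω) i j) μ)
        (_ : ∀ᵐ ω ∂μ, ∀ B : Matrix (Fin p) (Fin m) ℝ,
          pairwiseObjective (fun η => l₀ η (Y ω)) X
              (A * Real.sqrt (max K (1 / δ)) * lambdaO σ p m) (Bhat ω)
            ≤ pairwiseObjective (fun η => l₀ η (Y ω)) X
              (A * Real.sqrt (max K (1 / δ)) * lambdaO σ p m) B),
        Integrable (fun ω => ‖X * Bhat ω - X * Bstar‖ ^ 2) μ ∧
        ∫ ω, ‖X * Bhat ω - X * Bstar‖ ^ 2 ∂μ ≤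
          c * (max (K * δ) 1 * σ ^ 2 / δ ^ 2 *
            ((m : ℝ) + max (m : ℝ) p / p * clusterPen Bstar)) ∧
        max (K * δ) 1 * σ ^ 2 / δ ^ 2 * ((m : ℝ) + max (m : ℝ) p / p * clusterPen Bstar) ≤
          max (K * δ) 1 * σ ^ 2 / δ ^ 2 *
            ((m : ℝ) + max (m : ℝ) p * ((p : ℝ) - (p : ℝ) / numGroups Bstar)) ∧
        -- the rate of clustered reduced-rank learning is never larger, up to the constant
        max (K * δ) 1 * σ ^ 2 / δ ^ 2 * (crlComplexity X Bstar + 1) ≤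
          c * (max (K * δ) 1 * σ ^ 2 / δ ^ 2 *
            ((m : ℝ) + max (m : ℝ) p / p * clusterPen Bstar)) := by
  refine ⟨8, by norm_num, fun A hA => ⟨2 * A ^ 2 + 40, by positivity, ?_⟩⟩
  intro n p m hp hm Ω _ μ _ X Y l₀ _ Bstar σ δ K hσ hδ hK hE hcurv Bhat hmeas hopt
  have hR : 0 ≤ max (K * δ) 1 * σ ^ 2 / δ ^ 2 := by positivity
  have hC := clusterPen_nonneg Bstar hp
  obtain ⟨hint, hle⟩ :=
    integrable_and_integral_sq_error_le hA hp hm hσ hδ hK hE hcurv hmeas hopt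
  refine ⟨hint, hle, ?_, ?_⟩
  · have := rate_le Bstar hp
    gcongr
  · rw [mul_left_comm (2 * A ^ 2 + 40)]
    refine mul_le_mul_of_nonneg_left ?_ hR
    refine (crlComplexity_add_one_le Bstar X hp hm).trans ?_
    gcongr
    nlinarith [sq_nonneg A]
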